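/- Theorem 1.3. Let $G$ be a distribution function with $G(0)=0$, $G(1)=1$, having a density $g\ge 0$ on $(0,1]$ that is uniformly continuous on $(0,1]$, and suppose that $g$ is differentiable on $(0,1]$ with a derivative $g'=G''$ (one-sided at $1$) that is bounded and bounded away from zero: $0<c\le |g'(u)|\le C$ for all $u\in(0,1]$. Let $n,M,m,k\in\mathbb N$ vary along a sequence such that $M=km$, $n,M,m\to\infty$ and $n/M\to\lambda$ with $0<\lambda<\infty$, and suppose that for some $0<\alpha<1/6$ $$\frac{n}{m(\log m)^{1/(2\alpha)}}\to\infty .$$ For each member of the sequence let $X^{(1)},\dots,X^{(n)}$ be independent Multinomial$(1;p_{1,M},\dots,p_{M,M})$ random vectors, where $p_{j,M}=G(j/M)-G((j-1)/M)$, let $\nu_{j,M}=\sum_{i=1}^n X^{(i)}_{j}$ be the cell counts, $\bar\nu_{j,M}=\sum_{i=(j-1)k+1}^{jk}\nu_{i,M}$, $j=1,\dots,m$, the grouped counts, and $$\hat F_m(x)=\frac1m\sum_{j=1}^m I_{[\frac mn\bar\nu_{j,M}\le x]} .$$ Let $F$ be the distribution function of $g(U)$, with $U$ uniformly distributed on $(0,1]$.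 Then $F$ is the limit structural distribution function, that is, $F_M(y)=\frac1M\sum_{j=1}^M I_{[Mp_{j,M}\le y]}\to F(y)$ at every continuity point $y$ of $F$, and $F$ has a bounded density. Let $\tau$ be any upper bound of a density of $F$, let $x\in\mathbb R$ be fixed, and write $\mathrm{MSE}(\hat F_m(x))=\mathrm E(\hat F_m(x)-F(x))^2$. If $m/n^{1/3}\to\infty$, then $$\mathrm{MSE}(\hat F_m(x))\le \frac{9}{4\pi^2}(24\tau)^{4/3}\Big(\frac mn\Big)^{2/3}+\frac1{4m}+o\Big(\Big(\frac mn\Big)^{2/3}\Big)+o\Big(\frac1m\Big),$$ and if $m/n^{1/3}\to 0$, then $$\mathrm{MSE}(\hat F_m(x))\le \frac1{4m}+o\Big(\frac1m\Big).$$ -/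

import Mathlib

open MeasureTheory ProbabilityTheory Filter Topology Asymptotics
open scoped NNReal

/-- The cell probabilities `p_{j,M} = G(j/M) - G((j-1)/M)`, `j = 1, …, M`, generated by a
distribution function `G`. Cells are numbered from `0` here, so `j : Fin M` is the `(j+1)`-th
cell. -/
noncomputable def cellProb (G : ℝ → ℝ) (M : ℕ) (j : Fin M) : ℝ :=
  G (((j : ℕ) + 1 : ℝ) / M) - G (((j : ℕ) : ℝ) / M)

open Classical in
/-- The structural distribution function of a probability vector `p` on `M` cells: the empirical
distribution function of the `M` numbers `M * p j`. -/
noncomputable def structuralDF {M : ℕ} (p : Fin M → ℝ) (y : ℝ) : ℝ :=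
  (1 / (M : ℝ)) * ∑ j : Fin M, if (M : ℝ) * p j ≤ y then (1 : ℝ) else 0

/-- The observations `X 0, …, X (n-1)` are independent random vectors, each of which has the
Multinomial`(1; p)` law, i.e. equals the `j`-th unit vector with probability `p j`. -/
structure IsMultinomialSample {Ω : Type*} [MeasurableSpace Ω] (P : Measure Ω) {n M : ℕ}
    (p : Fin M → ℝ) (X : Fin n → Ω → Fin M → ℕ) : Prop where
  measurable : ∀ i, Measurable (X i)
  indep : iIndepFun X P
  law : ∀ i j, P.real {ω | X i ω = Pi.single j 1} = p j

/-- The cell counts `ν_j = ∑ i, X_j^{(i)}` of `n` observed vectors. -/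
def cellCount {n M : ℕ} (X : Fin n → Fin M → ℕ) (j : Fin M) : ℕ :=
  ∑ i : Fin n, X i j

/-- The grouped counts: the sum of the cell counts over the `j`-th block of `k` consecutive cells
(blocks, like cells, are numbered from `0`). -/
def groupedCount (k : ℕ) {n M : ℕ} (X : Fin n → Fin M → ℕ) (j : ℕ) : ℕ :=
  ∑ i ∈ (Finset.univ : Finset (Fin M)).filter
    (fun i : Fin M => j * k ≤ (i : ℕ) ∧ (i : ℕ) < (j + 1) * k), cellCount X i

open Classical in
/-- The estimator based on `m` groups of `k` cells each: the empirical distribution function of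
the `m` numbers `(m / n) * (grouped count)`. -/
noncomputable def groupedEstimator (m k : ℕ) {n M : ℕ} (X : Fin n → Fin M → ℕ) (y : ℝ) : ℝ :=
  (1 / (m : ℝ)) * ∑ j ∈ Finset.range m,
    if (m : ℝ) / n * (groupedCount k X j : ℝ) ≤ y then (1 : ℝ) else 0

/-- The law of `g(U)`, where `U` is uniformly distributed on `(0, 1]`. -/
noncomputable def limitLaw (g : ℝ → ℝ) : Measure ℝ :=
  (volume.restrict (Set.Ioc (0 : ℝ) 1)).map g

/-- The limit structural distribution function: the distribution function of `g(U)`. -/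
noncomputable def limitDF (g : ℝ → ℝ) (y : ℝ) : ℝ := cdf (limitLaw g) y

/-- `μ` has a density with respect to Lebesgue measure that is bounded by `τ`. -/
def HasDensityBoundedBy (μ : Measure ℝ) (τ : ℝ) : Prop :=
  ∃ f : ℝ → ℝ≥0, Measurable f ∧ (∀ y, (f y : ℝ) ≤ τ) ∧
    μ = volume.withDensity (fun y => (f y : ENNReal))

/-- `μ` has the density `g` (and no mass outside `(0, 1]`), where `g` is nonnegative and uniformly
continuous on `(0, 1]` and its derivative there (one-sided at `1`) is bounded and bounded away from
zero. So the distribution function of `μ` has a second derivative on `(0, 1]` that is bounded and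
bounded away from zero. -/
structure IsRegularDensity (μ : Measure ℝ) (g : ℝ → ℝ) : Prop where
  nonneg : ∀ u ∈ Set.Ioc (0 : ℝ) 1, 0 ≤ g u
  density : μ = (volume.restrict (Set.Ioc (0 : ℝ) 1)).withDensity (fun u => ENNReal.ofReal (g u))
  uniformContinuousOn : UniformContinuousOn g (Set.Ioc 0 1)
  deriv_bounds : ∃ (g' : ℝ → ℝ) (c C : ℝ), 0 < c ∧ ∀ u ∈ Set.Ioc (0 : ℝ) 1,
    HasDerivWithinAt g (g' u) (Set.Ioc 0 1) u ∧ c ≤ |g' u| ∧ |g' u| ≤ C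

/-- The mean squared error `E (F̂_m(x) - F(x))²` of the grouped estimator of `F`. -/
noncomputable def groupedMSE {Ω : Type*} [MeasurableSpace Ω] (P : Measure Ω) (m k : ℕ) {n M : ℕ}
    (X : Fin n → Ω → Fin M → ℕ) (F : ℝ → ℝ) (x : ℝ) : ℝ :=
  ∫ ω, (groupedEstimator m k (fun i => X i ω) x - F x) ^ 2 ∂P

/-! Everything rests on one nonasymptotic bound, `IsRegularDensity.exists_groupedMSE_le`: the mean
squared error is at most 1/(4m) + K(1/m² + m/n). Here 1/(4m) is the variance and the rest is squared
bias.

Variance: the block counts of a multinomial sample compete for the same observations, so the events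
that two of them stay below a threshold are negatively correlated (`integral_mul_le_of_antitone`).
The variance is thus at most that of m independent indicators.

Bias: let a_j be m times the increment of G over block j, which is a value of g inside the block. By
Chebyshev (`abs_prob_sub_mul_sq_le`) the probability that the normalized count is at most x differs
from the indicator of a_j ≤ x by at most min(1, V/(a_j - x)²), with V of order m/n. As |g'| ≥ c, the
a_j are separated at scale c/m, so these errors sum to O(1 + m√V) (`sum_le_of_separated`). Replacing
the indicators by F(x) costs another O(1/m), because |g'| is bounded. The bias is therefore O(1/m +
√(m/n)).

Since m/n → 0, the term m/n is o((m/n)^(2/3)); if m = o(n^(1/3)), it is even o(1/m). The same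
Riemann-sum comparison with V = 0 gives the convergence of the structural distribution functions. -/

/-! ### Regular densities and their distribution functions -/

/-- A regular density is bi-Lipschitz on `(0, 1]` and bounded. -/
theorem IsRegularDensity.exists_bounds {μ : Measure ℝ} {g : ℝ → ℝ} (hg : IsRegularDensity μ g) :
    ∃ c C : ℝ, 0 < c ∧ 0 < C ∧
      (∀ u ∈ Set.Ioc (0 : ℝ) 1, ∀ v ∈ Set.Ioc (0 : ℝ) 1, c * |u - v| ≤ |g u - g v|) ∧
      (∀ u ∈ Set.Ioc (0 : ℝ) 1, ∀ v ∈ Set.Ioc (0 : ℝ) 1, |g u - g v| ≤ C * |u - v|) ∧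
      ∀ u ∈ Set.Ioc (0 : ℝ) 1, g u ≤ C := by
  obtain ⟨g', c, C, hc, h⟩ := hg.deriv_bounds
  -- Slopes of chords are values of g', so bounds on |g'| pass to difference quotients whatever the
  -- sign of g'.
  have key : ∀ u ∈ Set.Ioc (0 : ℝ) 1, ∀ v ∈ Set.Ioc (0 : ℝ) 1, u < v →
      ∃ w ∈ Set.Ioc (0 : ℝ) 1, g' w = (g v - g u) / (v - u) := by
    intro u hu v hv huv
    have hcont : ContinuousOn g (Set.Icc u v) :=
      hg.uniformContinuousOn.continuousOn.mono fun w hw => ⟨hu.1.trans_le hw.1, hw.2.trans hv.2⟩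
    obtain ⟨w, hw, hw'⟩ := exists_hasDerivAt_eq_slope g g' huv hcont fun w hw =>
      ((h w ⟨hu.1.trans hw.1, hw.2.le.trans hv.2⟩).1).hasDerivAt
        (Ioc_mem_nhds (hu.1.trans hw.1) (hw.2.trans_le hv.2))
    exact ⟨w, ⟨hu.1.trans hw.1, hw.2.le.trans hv.2⟩, hw'⟩
  have key' : ∀ u ∈ Set.Ioc (0 : ℝ) 1, ∀ v ∈ Set.Ioc (0 : ℝ) 1,
      c * |u - v| ≤ |g u - g v| ∧ |g u - g v| ≤ C * |u - v| := by
    have aux : ∀ u ∈ Set.Ioc (0 : ℝ) 1, ∀ v ∈ Set.Ioc (0 : ℝ) 1, u < v →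
        c * |u - v| ≤ |g u - g v| ∧ |g u - g v| ≤ C * |u - v| := by
      intro u hu v hv huv
      obtain ⟨w, hw, hw'⟩ := key u hu v hv huv
      have hne : 0 < v - u := sub_pos.2 huv
      have e : |g u - g v| = |g' w| * |u - v| := by
        rw [abs_sub_comm (g u), abs_sub_comm u, ← abs_mul, hw', div_mul_cancel₀ _ hne.ne']
      rw [e]
      exact ⟨mul_le_mul_of_nonneg_right (h w hw).2.1 (abs_nonneg _),
        mul_le_mul_of_nonneg_right (h w hw).2.2 (abs_nonneg _)⟩
    intro u hu v hv
    rcases lt_trichotomy u v with huv | rfl | huv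
    · exact aux u hu v hv huv
    · simp
    · rw [abs_sub_comm u, abs_sub_comm (g u)]
      exact aux v hv u hu huv
  have h1 : (1 : ℝ) ∈ Set.Ioc (0 : ℝ) 1 := ⟨one_pos, le_rfl⟩
  have hC : 0 < C := hc.trans_le ((h 1 h1).2.1.trans (h 1 h1).2.2)
  have hg1 := hg.nonneg 1 h1
  -- One constant serves as Lipschitz constant and as upper bound: g(u) ≤ g(1) + C|u - 1|.
  refine ⟨c, C + g 1, hc, by positivity, fun u hu v hv => (key' u hu v hv).1,
    fun u hu v hv => (key' u hu v hv).2.trans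
      (mul_le_mul_of_nonneg_right (by linarith) (abs_nonneg _)), fun u hu => ?_⟩
  have h2 := (abs_le.1 (key' u hu 1 h1).2).2
  have h3 : |u - 1| ≤ 1 := abs_le.2 ⟨by linarith [hu.1], by linarith [hu.2]⟩
  nlinarith

/-- Mean value theorem for the distribution function of a regular density. -/
theorem IsRegularDensity.exists_cdf_sub_eq {μ : Measure ℝ} [IsProbabilityMeasure μ] {g : ℝ → ℝ}
    (hg : IsRegularDensity μ g) {a b : ℝ} (ha : 0 ≤ a) (hab : a < b) (hb : b ≤ 1) :
    ∃ u ∈ Set.Ioo a b, cdf μ b - cdf μ a = g u * (b - a) := by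
  obtain ⟨c, C, -, -, -, -, hC⟩ := hg.exists_bounds
  have hcont : ContinuousOn g (Set.Ioc 0 1) := hg.uniformContinuousOn.continuousOn
  have hmeas : AEStronglyMeasurable g (volume.restrict (Set.Ioc 0 1)) :=
    hcont.aestronglyMeasurable measurableSet_Ioc
  have hint : IntegrableOn g (Set.Ioc 0 1) :=
    IntegrableOn.of_bound (by simp) hmeas C ((ae_restrict_iff' measurableSet_Ioc).2
      (Eventually.of_forall fun u hu => by
        rw [Real.norm_eq_abs, abs_of_nonneg (hg.nonneg u hu)]; exact hC u hu))
  have hG : ∀ v, a ≤ v → v ≤ b → cdf μ v - cdf μ a = ∫ t in a..v, g t := by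
    intro v hav hvb
    have hsub : Set.Ioc a v ⊆ Set.Ioc 0 1 := fun t ht =>
      ⟨ha.trans_lt ht.1, ht.2.trans (hvb.trans hb)⟩
    rw [intervalIntegral.integral_of_le hav, cdf_eq_real, cdf_eq_real,
      ← measureReal_sdiff (Set.Iic_subset_Iic.2 hav) measurableSet_Iic, Set.Iic_sdiff_Iic,
      measureReal_def, hg.density, withDensity_apply _ measurableSet_Ioc,
      Measure.restrict_restrict measurableSet_Ioc, Set.inter_eq_left.2 hsub,
      integral_eq_lintegral_of_nonneg_ae]
    · exact (ae_restrict_iff' measurableSet_Ioc).2 (Eventually.of_forall fun t ht =>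
        hg.nonneg t (hsub ht))
    · exact (hint.mono_set hsub).aestronglyMeasurable
  have hintI : IntegrableOn g (Set.Icc a b) := by
    rw [integrableOn_Icc_iff_integrableOn_Ioc]
    exact hint.mono_set fun t ht => ⟨ha.trans_lt ht.1, ht.2.trans hb⟩
  -- The primitive has to be differentiable only inside (a, b), so a = 0 is allowed although g is
  -- not controlled there.
  obtain ⟨u, hu, hu'⟩ := exists_hasDerivAt_eq_slope (fun v => ∫ t in a..v, g t) g hab
    (by
      have := intervalIntegral.continuousOn_primitive_interval (μ := volume) (a := a) (b := b)
        (f := g) (by rwa [Set.uIcc_of_le hab.le])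
      rwa [Set.uIcc_of_le hab.le] at this)
    (fun v hv => by
      have hv' : Set.Ioo (0 : ℝ) 1 ∈ 𝓝 v :=
        Ioo_mem_nhds (ha.trans_lt hv.1) (hv.2.trans_le hb)
      refine intervalIntegral.integral_hasDerivAt_right ?_ ?_ ?_
      · rw [intervalIntegrable_iff_integrableOn_Ioc_of_le hv.1.le]
        exact hintI.mono_set fun t ht => ⟨ht.1.le, ht.2.trans hv.2.le⟩
      · exact (hcont.mono Set.Ioo_subset_Ioc_self).stronglyMeasurableAtFilter isOpen_Ioo v
          (mem_of_mem_nhds hv')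
      · exact hcont.continuousAt (mem_of_superset hv' Set.Ioo_subset_Ioc_self))
  refine ⟨u, hu, ?_⟩
  rw [hu', hG b hab.le le_rfl, intervalIntegral.integral_same, sub_zero,
    div_mul_cancel₀ _ (sub_pos.2 hab).ne']

/-! ### The limit law and its bounded density -/

/-- A regular density is almost everywhere measurable for the uniform distribution on `(0, 1]`. -/
theorem IsRegularDensity.aemeasurable {μ : Measure ℝ} {g : ℝ → ℝ} (hg : IsRegularDensity μ g) :
    AEMeasurable g (volume.restrict (Set.Ioc 0 1)) :=
  hg.uniformContinuousOn.continuousOn.aemeasurable measurableSet_Ioc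

theorem IsRegularDensity.isProbabilityMeasure_limitLaw {μ : Measure ℝ} {g : ℝ → ℝ}
    (hg : IsRegularDensity μ g) : IsProbabilityMeasure (limitLaw g) :=
  have : IsProbabilityMeasure (volume.restrict (Set.Ioc (0 : ℝ) 1)) := ⟨by simp⟩
  Measure.isProbabilityMeasure_map hg.aemeasurable

/-- The law of `g(U)` is bounded by a multiple of Lebesgue measure. -/
theorem IsRegularDensity.exists_hasDensityBoundedBy {μ : Measure ℝ} {g : ℝ → ℝ}
    (hg : IsRegularDensity μ g) : ∃ τ : ℝ, HasDensityBoundedBy (limitLaw g) τ := by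
  obtain ⟨c, C, hc, -, hlow, -, -⟩ := hg.exists_bounds
  have hinj : Set.InjOn g (Set.Ioc 0 1) := fun u hu v hv huv => by
    have := hlow u hu v hv
    rw [huv, sub_self, abs_zero] at this
    exact sub_eq_zero.1 (abs_eq_zero.1 (le_antisymm (by nlinarith) (abs_nonneg _)))
  have hprob := hg.isProbabilityMeasure_limitLaw
  set K : ℝ≥0 := Real.toNNReal c⁻¹ with hK
  have hKc : (K : ℝ) = c⁻¹ := Real.coe_toNNReal _ (by positivity)
  -- The inverse of g is Lipschitz with constant 1/c on the image of g, and one-dimensional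
  -- Hausdorff measure is Lebesgue measure; hence preimages are at most 1/c times as long.
  have hle : ∀ s, MeasurableSet s → limitLaw g s ≤ K * volume s := by
    intro s hs
    rw [limitLaw, Measure.map_apply_of_aemeasurable hg.aemeasurable hs,
      Measure.restrict_apply₀' measurableSet_Ioc.nullMeasurableSet]
    have hlip : LipschitzOnWith K (Function.invFunOn g (Set.Ioc 0 1))
        (g '' (g ⁻¹' s ∩ Set.Ioc 0 1)) := by
      refine LipschitzOnWith.of_dist_le_mul ?_
      rintro _ ⟨u, hu, rfl⟩ _ ⟨v, hv, rfl⟩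
      rw [hinj.leftInvOn_invFunOn hu.2, hinj.leftInvOn_invFunOn hv.2, Real.dist_eq,
        Real.dist_eq, hKc, inv_mul_eq_div, le_div_iff₀ hc, mul_comm]
      exact hlow u hu.2 v hv.2
    have h := hlip.hausdorffMeasure_image_le (d := 1) zero_le_one
    rw [(hinj.leftInvOn_invFunOn.mono Set.inter_subset_right).image_image,
      hausdorffMeasure_real, ENNReal.rpow_one] at h
    refine h.trans ?_
    gcongr
    rintro _ ⟨u, hu, rfl⟩
    exact hu.1
  have hac : limitLaw g ≪ volume := Measure.AbsolutelyContinuous.mk fun s hs h0 => by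
    simpa [h0] using hle s hs
  have hbd : (limitLaw g).rnDeriv volume ≤ᵐ[volume] fun _ => (K : ENNReal) := by
    refine ae_le_of_forall_setLIntegral_le_of_sigmaFinite (Measure.measurable_rnDeriv _ _)
      fun s hs _ => ?_
    rw [setLIntegral_const]
    exact (Measure.setLIntegral_rnDeriv_le s).trans (hle s hs)
  -- The Radon–Nikodym derivative is at most K only almost everywhere; truncating it makes the bound
  -- hold everywhere.
  refine ⟨K, fun y => (min ((limitLaw g).rnDeriv volume y) K).toNNReal,
    ((Measure.measurable_rnDeriv _ _).min measurable_const).ennreal_toNNReal, fun y => ?_, ?_⟩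
  · have : (min ((limitLaw g).rnDeriv volume y) K).toNNReal ≤ K :=
      ENNReal.toNNReal_mono ENNReal.coe_ne_top (min_le_right _ _)
    exact_mod_cast this
  · rw [← Measure.withDensity_rnDeriv_eq _ _ hac]
    refine withDensity_congr_ae ?_
    rw [Measure.withDensity_rnDeriv_eq _ _ hac]
    filter_upwards [hbd] with y hy
    rw [ENNReal.coe_toNNReal ((min_le_right _ _).trans_lt ENNReal.coe_lt_top).ne, min_eq_left hy]

/-- The limit distribution function as the length of a sublevel set. -/
theorem IsRegularDensity.limitDF_eq {μ : Measure ℝ} {g : ℝ → ℝ} (hg : IsRegularDensity μ g)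
    (y : ℝ) : limitDF g y = volume.real ({u | g u ≤ y} ∩ Set.Ioc 0 1) := by
  have hprob := hg.isProbabilityMeasure_limitLaw
  rw [limitDF, cdf_eq_real, measureReal_def, limitLaw,
    Measure.map_apply_of_aemeasurable hg.aemeasurable measurableSet_Iic,
    Measure.restrict_apply₀' measurableSet_Ioc.nullMeasurableSet, measureReal_def]
  rfl

/-! ### Sums over separated points -/

/-- `∑ min (1, B² / i²) ≤ 6 B`, in telescoped form. -/
theorem sum_range_le_of_mul_sq_le {B : ℝ} (hB : 1 ≤ B) {t : ℕ → ℝ} (ht : ∀ i, t i ≤ 1)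
    (ht' : ∀ i, t i * ((i : ℝ) + 1) ^ 2 ≤ B ^ 2) (N : ℕ) :
    ∑ i ∈ Finset.range N, t i ≤ 6 * B - 6 * B ^ 2 / (N + B) := by
  induction N with
  | zero =>
    simp only [Finset.range_zero, Finset.sum_empty, Nat.cast_zero, zero_add]
    rw [sq, ← mul_assoc, mul_div_assoc, div_self (by positivity)]
    linarith
  | succ N ih =>
    rw [Finset.sum_range_succ]
    have hN : (0 : ℝ) ≤ N := Nat.cast_nonneg N
    have e : 6 * B ^ 2 / (N + B) - 6 * B ^ 2 / (((N + 1 : ℕ) : ℝ) + B)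
        = 6 * B ^ 2 / ((N + B) * (N + 1 + B)) := by
      push_cast
      field_simp
      ring
    -- Both factors of the denominator are at most 2 max(B, N + 1), so t ≤ 1 suffices for N + 1 ≤ B
    -- and the quadratic bound otherwise; 6 leaves slack over 4.
    have key : t N ≤ 6 * B ^ 2 / ((N + B) * (N + 1 + B)) := by
      rw [le_div_iff₀ (by positivity)]
      have h1 := ht N
      have h2 := ht' N
      rcases le_total ((N : ℝ) + 1) B with h | h
      · have : (N + B) * (N + 1 + B) ≤ 6 * B ^ 2 := by nlinarith
        nlinarith [mul_nonneg (by positivity : 0 ≤ (N : ℝ) + B)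
          (by positivity : (0 : ℝ) ≤ N + 1 + B)]
      · by_cases h0 : 0 ≤ t N
        · have : (N + B) * (N + 1 + B) ≤ 6 * ((N : ℝ) + 1) ^ 2 := by nlinarith
          nlinarith
        · have : 0 ≤ (N + B) * (N + 1 + B) := by positivity
          nlinarith
    linarith

/-- If `a 0, …, a (m-1)` are separated, with gaps of order `c / m`, and `t j` is at most
`min (1, V / (a j - x)²)`, then `∑ t j` is at most of order `1 + m √V / c`. -/
theorem sum_le_of_separated {m : ℕ} (hm : 0 < m) {a t : ℕ → ℝ} {c x V : ℝ} (hc : 0 < c)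
    (hV : 0 ≤ V)
    (hsep : ∀ i < m, ∀ j < m, c * (|(i : ℝ) - j| - 1) ≤ m * |a i - a j|)
    (ht : ∀ j < m, t j ≤ 1) (ht' : ∀ j < m, t j * (a j - x) ^ 2 ≤ V) :
    ∑ j ∈ Finset.range m, t j ≤ 13 * (1 + 4 * (m * √V) / c) := by
  set B := 1 + 4 * (m * √V) / c with hBdef
  have hB : 1 ≤ B := le_add_of_nonneg_right (by positivity)
  -- The index of the point nearest to x serves as origin: |a_j - a_{j₀}| ≤ 2|a_j - x|, so
  -- separation from a_{j₀} gives separation from x.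
  obtain ⟨j₀, hj₀, hmin⟩ := Finset.exists_min_image (Finset.range m) (fun j => |a j - x|)
    ⟨0, Finset.mem_range.2 hm⟩
  rw [Finset.mem_range] at hj₀
  have key : ∀ j < m, 1 ≤ |(j : ℝ) - j₀| →
      t j * |(j : ℝ) - j₀| ^ 2 ≤ B ^ 2 := by
    intro j hj h1
    set d := |(j : ℝ) - j₀| with hd
    have hBpos : 0 ≤ B ^ 2 := by positivity
    by_cases htj : t j ≤ 0
    · exact (mul_nonpos_of_nonpos_of_nonneg htj (sq_nonneg _)).trans hBpos
    push Not at htj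
    -- The gap hypothesis offers d - 1, which is at least d/2 once d ≥ 2; the neighbours d = 1 use
    -- only t ≤ 1 ≤ B².
    by_cases h2 : d < 2
    · have hd1 : d = 1 := by
        have e : d = ((|(j : ℤ) - j₀| : ℤ) : ℝ) := by push_cast; exact hd
        rw [e] at h1 h2 ⊢
        have h1' : (1 : ℤ) ≤ |(j : ℤ) - j₀| := by exact_mod_cast h1
        have h2' : |(j : ℤ) - j₀| < 2 := by exact_mod_cast h2
        have : |(j : ℤ) - j₀| = 1 := by omega
        rw [this]; norm_num
      rw [hd1]
      nlinarith [ht j hj]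
    · push Not at h2
      have hs := hsep j hj j₀ hj₀
      have hm' : (0 : ℝ) < m := by exact_mod_cast hm
      have tri : |a j - a j₀| ≤ 2 * |a j - x| := by
        have h3 := hmin j (Finset.mem_range.2 hj)
        have h4 := abs_sub_le (a j) x (a j₀)
        rw [abs_sub_comm x] at h4
        linarith
      have hcd : c * d ≤ 4 * (m * |a j - x|) := by
        rw [← hd] at hs
        nlinarith
      have hcd2 : (c * d) ^ 2 ≤ (4 * (m * |a j - x|)) ^ 2 :=
        pow_le_pow_left₀ (by positivity) hcd 2
      have hfin : c ^ 2 * (t j * d ^ 2) ≤ (4 * (m * √V)) ^ 2 := by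
        calc c ^ 2 * (t j * d ^ 2) = t j * (c * d) ^ 2 := by ring
          _ ≤ t j * (4 * (m * |a j - x|)) ^ 2 := by gcongr
          _ = 16 * m ^ 2 * (t j * (a j - x) ^ 2) := by rw [mul_pow, mul_pow, sq_abs]; ring
          _ ≤ 16 * m ^ 2 * V := by gcongr; exact ht' j hj
          _ = (4 * (m * √V)) ^ 2 := by rw [mul_pow, mul_pow, Real.sq_sqrt hV]; ring
      calc t j * d ^ 2 = c ^ 2 * (t j * d ^ 2) / c ^ 2 := by field_simp
        _ ≤ (4 * (m * √V)) ^ 2 / c ^ 2 := by gcongr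
        _ = (4 * (m * √V) / c) ^ 2 := by rw [div_pow]
        _ ≤ B ^ 2 := by gcongr; rw [hBdef]; linarith
  -- split the sum at the index `j₀`
  have hsplit : ∑ j ∈ Finset.range m, t j = ∑ i ∈ Finset.range j₀, t (j₀ - 1 - i) + t j₀
      + ∑ i ∈ Finset.range (m - (j₀ + 1)), t (j₀ + 1 + i) := by
    rw [Finset.sum_range_reflect, ← Finset.sum_range_succ, ← Finset.sum_range_add,
      Nat.add_sub_cancel' hj₀]
  have hright : ∑ i ∈ Finset.range (m - (j₀ + 1)), t (j₀ + 1 + i) ≤ 6 * B := by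
    have := sum_range_le_of_mul_sq_le hB
      -- Extension by zero, as the summation bound requires its hypotheses at every index.
      (t := fun i => if i < m - (j₀ + 1) then t (j₀ + 1 + i) else 0)
      (fun i => by
        split_ifs with h
        · exact ht _ (by omega)
        · exact zero_le_one)
      (fun i => by
        split_ifs with h
        · have e : |((j₀ + 1 + i : ℕ) : ℝ) - j₀| = (i : ℝ) + 1 := by
            push_cast
            rw [abs_of_nonneg] <;> linarith [(Nat.cast_nonneg i : (0 : ℝ) ≤ i)]
          have := key (j₀ + 1 + i) (by omega)
            (by rw [e]; linarith [(Nat.cast_nonneg i : (0 : ℝ) ≤ i)])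
          rwa [e] at this
        · rw [zero_mul]; positivity) (m - (j₀ + 1))
    rw [Finset.sum_congr rfl fun i hi => if_pos (Finset.mem_range.1 hi)] at this
    exact this.trans (sub_le_self _ (by positivity))
  have hleft : ∑ i ∈ Finset.range j₀, t (j₀ - 1 - i) ≤ 6 * B := by
    have := sum_range_le_of_mul_sq_le hB
      (t := fun i => if i < j₀ then t (j₀ - 1 - i) else 0)
      (fun i => by
        split_ifs with h
        · exact ht _ (by omega)
        · exact zero_le_one)
      (fun i => by
        split_ifs with h
        · have e : |((j₀ - 1 - i : ℕ) : ℝ) - j₀| = (i : ℝ) + 1 := by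
            have : ((j₀ - 1 - i : ℕ) : ℝ) = j₀ - 1 - i := by
              rw [Nat.sub_sub, Nat.cast_sub (by omega)]; push_cast; ring
            rw [this, abs_sub_comm, abs_of_nonneg] <;>
              linarith [(Nat.cast_nonneg i : (0 : ℝ) ≤ i)]
          have := key (j₀ - 1 - i) (by omega)
            (by rw [e]; linarith [(Nat.cast_nonneg i : (0 : ℝ) ≤ i)])
          rwa [e] at this
        · rw [zero_mul]; positivity) j₀
    rw [Finset.sum_congr rfl fun i hi => if_pos (Finset.mem_range.1 hi)] at this
    exact this.trans (sub_le_self _ (by positivity))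
  -- The two sides contribute 6B each and the centre at most 1 ≤ B, which gives 13B.
  rw [hsplit]
  linarith [ht j₀ hj₀]

/-! ### Riemann sums and convergence of the structural distribution function -/

/-- The normalized increments of the distribution function over a grid of mesh `1 / m` are values
of the density. -/
theorem IsRegularDensity.exists_mul_cdf_sub_eq {μ : Measure ℝ} [IsProbabilityMeasure μ]
    {g : ℝ → ℝ} (hg : IsRegularDensity μ g) {m j : ℕ} (hj : j < m) :
    ∃ u ∈ Set.Ioo ((j : ℝ) / m) (((j : ℝ) + 1) / m), u ∈ Set.Ioc (0 : ℝ) 1 ∧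
      m * (cdf μ (((j : ℝ) + 1) / m) - cdf μ ((j : ℝ) / m)) = g u := by
  have hm : (0 : ℝ) < m := by exact_mod_cast (Nat.zero_le j).trans_lt hj
  have hj' : (j : ℝ) + 1 ≤ m := by exact_mod_cast hj
  have hb : ((j : ℝ) + 1) / m ≤ 1 := (div_le_one hm).2 hj'
  have ha : 0 ≤ (j : ℝ) / m := by positivity
  obtain ⟨u, hu, h⟩ := hg.exists_cdf_sub_eq ha
    (div_lt_div_of_pos_right (lt_add_one (j : ℝ)) hm) hb
  refine ⟨u, hu, ⟨ha.trans_lt hu.1, hu.2.le.trans hb⟩, ?_⟩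
  rw [h, div_sub_div_same, add_sub_cancel_left]
  field_simp

/-- The length of a subset of `(0, 1]` is the sum of the lengths in the cells of a grid. -/
theorem measureReal_inter_Ioc_eq_sum (S : Set ℝ) {m : ℕ} (hm : 0 < m)
    (hS : NullMeasurableSet (S ∩ Set.Ioc 0 1)) :
    volume.real (S ∩ Set.Ioc 0 1) = ∑ j ∈ Finset.range m,
      volume.real (S ∩ Set.Ioc ((j : ℝ) / m) (((j : ℝ) + 1) / m)) := by
  have hm' : (0 : ℝ) < m := by exact_mod_cast hm
  have key : ∀ N ≤ m, volume.real (S ∩ Set.Ioc 0 ((N : ℝ) / m)) = ∑ j ∈ Finset.range N,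
      volume.real (S ∩ Set.Ioc ((j : ℝ) / m) (((j : ℝ) + 1) / m)) := by
    intro N
    induction N with
    | zero => simp
    | succ N ih =>
      intro hN
      have h1 : (N : ℝ) / m ≤ ((N : ℝ) + 1) / m := by gcongr; linarith
      have h0 : 0 ≤ (N : ℝ) / m := by positivity
      have h2 : ((N : ℝ) + 1) / m ≤ 1 := by
        rw [div_le_one hm']; exact_mod_cast hN
      rw [Finset.sum_range_succ, ← ih (by omega), Nat.cast_succ,
        ← Set.Ioc_union_Ioc_eq_Ioc h0 h1, Set.inter_union_distrib_left]
      refine measureReal_union₀ ?_ ?_ ?_ ?_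
      · have : S ∩ Set.Ioc ((N : ℝ) / m) (((N : ℝ) + 1) / m)
            = (S ∩ Set.Ioc 0 1) ∩ Set.Ioc ((N : ℝ) / m) (((N : ℝ) + 1) / m) := by
          rw [Set.inter_assoc, Set.inter_eq_right.2 (Set.Ioc_subset_Ioc h0 h2)]
        rw [this]
        exact hS.inter measurableSet_Ioc.nullMeasurableSet
      · refine (Disjoint.mono Set.inter_subset_right Set.inter_subset_right ?_).aedisjoint
        exact Set.Ioc_disjoint_Ioc_of_le le_rfl
      · exact ((measure_mono Set.inter_subset_right).trans_lt measure_Ioc_lt_top).ne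
      · exact ((measure_mono Set.inter_subset_right).trans_lt measure_Ioc_lt_top).ne
  have := key m le_rfl
  rwa [div_self hm'.ne'] at this

open Classical in
/-- Riemann-sum approximation of the limit distribution function: if the numbers `q j` differ from
the indicators that the normalized increments are at most `x` only for increments near `x`, then
their average is near `F x`. -/
theorem IsRegularDensity.exists_abs_sub_limitDF_le {μ : Measure ℝ} [IsProbabilityMeasure μ]
    {g : ℝ → ℝ} (hg : IsRegularDensity μ g) :
    ∃ K : ℝ, 0 < K ∧ ∀ (m : ℕ), 0 < m → ∀ (a q : ℕ → ℝ) (x V : ℝ),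
      (∀ j, a j = m * (cdf μ (((j : ℝ) + 1) / m) - cdf μ ((j : ℝ) / m))) → 0 ≤ V →
      (∀ j < m, 0 ≤ q j ∧ q j ≤ 1) →
      (∀ j < m, |q j - if a j ≤ x then 1 else 0| * (a j - x) ^ 2 ≤ V) →
      |1 / m * ∑ j ∈ Finset.range m, q j - limitDF g x| ≤ K * (1 / m + √V) := by
  obtain ⟨c, C, hc, hC, hlow, hup, -⟩ := hg.exists_bounds
  refine ⟨26 * (1 + 4 * C / c) + 52 / c, by positivity, fun m hm a q x V ha hV hq hqV => ?_⟩
  have hm' : (0 : ℝ) < m := by exact_mod_cast hm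
  have hgrid : ∀ j < m, ∃ u ∈ Set.Ioo ((j : ℝ) / m) (((j : ℝ) + 1) / m),
      u ∈ Set.Ioc (0 : ℝ) 1 ∧ a j = g u := fun j hj => by
    rw [ha]; exact hg.exists_mul_cdf_sub_eq hj
  have hsep : ∀ i < m, ∀ j < m, c * (|(i : ℝ) - j| - 1) ≤ m * |a i - a j| := by
    intro i hi j hj
    obtain ⟨u, hu, hu', hau⟩ := hgrid i hi
    obtain ⟨v, hv, hv', hav⟩ := hgrid j hj
    have h := hlow u hu' v hv'
    rw [hau, hav]
    have hu1 := (div_lt_iff₀ hm').1 hu.1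
    have hu2 := (lt_div_iff₀ hm').1 hu.2
    have hv1 := (div_lt_iff₀ hm').1 hv.1
    have hv2 := (lt_div_iff₀ hm').1 hv.2
    have h3 : |(i : ℝ) - j| - 1 ≤ m * |u - v| := by
      have e : (m : ℝ) * |u - v| = |m * (u - v)| := by rw [abs_mul, abs_of_pos hm']
      rw [e, sub_le_iff_le_add, abs_le]
      constructor
      · have := neg_abs_le ((m : ℝ) * (u - v)); nlinarith
      · have := le_abs_self ((m : ℝ) * (u - v)); nlinarith
    calc c * (|(i : ℝ) - j| - 1) ≤ c * (m * |u - v|) := by gcongr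
      _ = m * (c * |u - v|) := by ring
      _ ≤ m * |g u - g v| := by gcongr
  set S : Set ℝ := {u | g u ≤ x} with hS
  -- The fraction of cell j on which g ≤ x. The average of these fractions is exactly F(x), so both
  -- q and s can be compared with the indicators of a_j ≤ x.
  set s : ℕ → ℝ := fun j =>
    m * volume.real (S ∩ Set.Ioc ((j : ℝ) / m) (((j : ℝ) + 1) / m)) with hs
  -- Nothing is known about g outside (0, 1], so only this part of the sublevel set is null
  -- measurable.
  have hSnull : NullMeasurableSet (S ∩ Set.Ioc 0 1) := by
    have := hg.aemeasurable.nullMeasurable (measurableSet_Iic (a := x))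
    rwa [nullMeasurableSet_restrict measurableSet_Ioc.nullMeasurableSet] at this
  have hF : limitDF g x = 1 / m * ∑ j ∈ Finset.range m, s j := by
    rw [hg.limitDF_eq, measureReal_inter_Ioc_eq_sum _ hm hSnull, ← Finset.mul_sum, ← mul_assoc,
      one_div_mul_cancel hm'.ne', one_mul]
  have hlen : ∀ j : ℕ, volume.real (Set.Ioc ((j : ℝ) / m) (((j : ℝ) + 1) / m)) = 1 / m := by
    intro j
    rw [Real.volume_real_Ioc_of_le (div_le_div_of_nonneg_right (by linarith) hm'.le), div_sub_div_same, add_sub_cancel_left]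
  have hs1 : ∀ j, 0 ≤ s j ∧ s j ≤ 1 := fun j => by
    refine ⟨by positivity, ?_⟩
    have : volume.real (S ∩ Set.Ioc ((j : ℝ) / m) (((j : ℝ) + 1) / m)) ≤ 1 / m := by
      rw [← hlen j]
      exact measureReal_mono Set.inter_subset_right measure_Ioc_lt_top.ne
    calc s j ≤ m * (1 / m) := mul_le_mul_of_nonneg_left this hm'.le
      _ = 1 := by field_simp
  -- On a cell g stays within C/m of a_j, so the fraction equals the indicator unless |a_j - x| ≤
  -- C/m.
  have hsV : ∀ j < m, |s j - if a j ≤ x then 1 else 0| * (a j - x) ^ 2 ≤ (C / m) ^ 2 := by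
    intro j hj
    obtain ⟨u, hu, hu', hau⟩ := hgrid j hj
    have h1 : |s j - if a j ≤ x then 1 else 0| ≤ 1 := by
      have := hs1 j
      split_ifs <;> rw [abs_le] <;> constructor <;> linarith
    by_cases hnear : |a j - x| ≤ C / m
    · calc _ ≤ 1 * (C / m) ^ 2 := by
            rw [← sq_abs (a j - x)]
            exact mul_le_mul h1 (pow_le_pow_left₀ (abs_nonneg _) hnear 2) (by positivity)
              zero_le_one
        _ = _ := one_mul _
    · push Not at hnear
      have hclose : ∀ v ∈ Set.Ioc ((j : ℝ) / m) (((j : ℝ) + 1) / m), |g v - a j| ≤ C / m := by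
        intro v hv
        have hv' : v ∈ Set.Ioc (0 : ℝ) 1 := by
          refine ⟨lt_of_le_of_lt (by positivity) hv.1, hv.2.trans ?_⟩
          rw [div_le_one hm']; exact_mod_cast hj
        rw [hau]
        refine (hup v hv' u hu').trans ?_
        rw [div_eq_mul_one_div]
        gcongr
        have e : ((j : ℝ) + 1) / m = j / m + 1 / m := add_div _ _ _
        rw [e] at hv hu
        rw [abs_le]
        constructor <;> linarith [hv.1, hv.2, hu.1, hu.2]
      have hz : s j = if a j ≤ x then 1 else 0 := by
        split_ifs with hax
        · have : S ∩ Set.Ioc ((j : ℝ) / m) (((j : ℝ) + 1) / m)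
              = Set.Ioc ((j : ℝ) / m) (((j : ℝ) + 1) / m) := by
            refine Set.inter_eq_right.2 fun v hv => ?_
            have h2 := (abs_le.1 (hclose v hv)).2
            rw [abs_of_nonpos (by linarith)] at hnear
            simp only [hS, Set.mem_ofPred_eq]
            linarith
          simp only [hs]
          rw [this, hlen]
          field_simp
        · have : S ∩ Set.Ioc ((j : ℝ) / m) (((j : ℝ) + 1) / m) = ∅ := by
            refine Set.eq_empty_iff_forall_notMem.2 fun v hv => ?_
            have h2 := (abs_le.1 (hclose v hv.2)).1
            have h3 : g v ≤ x := hv.1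
            rw [abs_of_pos (by linarith)] at hnear
            linarith
          simp only [hs]
          rw [this]
          simp
      rw [hz, sub_self, abs_zero, zero_mul]
      positivity
  have hbound := fun (r : ℕ → ℝ) (W : ℝ) (hW : 0 ≤ W) (hr : ∀ j < m, 0 ≤ r j ∧ r j ≤ 1)
      (hrW : ∀ j < m, |r j - if a j ≤ x then 1 else 0| * (a j - x) ^ 2 ≤ W) =>
    sum_le_of_separated hm (t := fun j => |r j - if a j ≤ x then 1 else 0|) hc hW hsep
      (fun j hj => by
        have := hr j hj
        split_ifs <;> rw [abs_le] <;> constructor <;> linarith) hrW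
  have hb1 := hbound q V hV hq hqV
  have hb2 := hbound s ((C / m) ^ 2) (by positivity) (fun j _ => hs1 j) hsV
  rw [Real.sqrt_sq (by positivity)] at hb2
  have e : (m : ℝ) * (C / m) = C := by field_simp
  rw [e] at hb2
  have htri : |∑ j ∈ Finset.range m, q j - ∑ j ∈ Finset.range m, s j|
      ≤ ∑ j ∈ Finset.range m, |q j - if a j ≤ x then 1 else 0|
        + ∑ j ∈ Finset.range m, |s j - if a j ≤ x then 1 else 0| := by
    rw [← Finset.sum_sub_distrib, ← Finset.sum_add_distrib]
    refine (Finset.abs_sum_le_sum_abs _ _).trans (Finset.sum_le_sum fun j _ => ?_)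
    have := abs_sub_le (q j) (if a j ≤ x then 1 else 0) (s j)
    rwa [abs_sub_comm (if a j ≤ x then 1 else 0) (s j)] at this
  rw [hF, ← mul_sub, abs_mul, abs_of_pos (by positivity)]
  calc 1 / (m : ℝ) * |∑ j ∈ Finset.range m, q j - ∑ j ∈ Finset.range m, s j|
      ≤ 1 / m * (13 * (1 + 4 * (m * √V) / c) + 13 * (1 + 4 * C / c)) := by
        gcongr; linarith
    _ = (13 + 13 * (1 + 4 * C / c)) * (1 / m) + 52 / c * √V := by field_simp; ring
    _ ≤ (26 * (1 + 4 * C / c) + 52 / c) * (1 / m) + (26 * (1 + 4 * C / c) + 52 / c) * √V := by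
        have : 0 ≤ 4 * C / c := by positivity
        have : 0 ≤ 52 / c := by positivity
        exact add_le_add (mul_le_mul_of_nonneg_right (by linarith) (by positivity))
          (mul_le_mul_of_nonneg_right (by linarith) (Real.sqrt_nonneg _))
    _ = _ := by ring

/-- The structural distribution functions converge to the limit distribution function. -/
theorem IsRegularDensity.tendsto_structuralDF {μ : Measure ℝ} [IsProbabilityMeasure μ]
    {g : ℝ → ℝ} (hg : IsRegularDensity μ g) {M : ℕ → ℕ} (hM : Tendsto M atTop atTop) (y : ℝ) :
    Tendsto (fun l => structuralDF (cellProb (cdf μ) (M l)) y) atTop (𝓝 (limitDF g y)) := by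
  classical
  obtain ⟨K, -, h⟩ := hg.exists_abs_sub_limitDF_le
  rw [tendsto_iff_dist_tendsto_zero]
  refine squeeze_zero' (Eventually.of_forall fun _ => dist_nonneg) ?_
    (g := fun l => K * (1 / (M l : ℝ))) ?_
  · filter_upwards [hM.eventually_gt_atTop 0] with l hl
    -- Taking q to be the indicators themselves allows V = 0.
    have := h (M l) hl _
      (fun j => if (M l : ℝ) * (cdf μ (((j : ℝ) + 1) / M l) - cdf μ ((j : ℝ) / M l)) ≤ y
        then 1 else 0) y 0 (fun _ => rfl) le_rfl
      (fun j _ => by split_ifs <;> norm_num) (fun j _ => by simp)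
    rw [Real.sqrt_zero, add_zero, Finset.sum_range] at this
    rw [Real.dist_eq, structuralDF]
    convert this using 5
    exact if_congr Iff.rfl rfl rfl
  · have : Tendsto (fun l => 1 / (M l : ℝ)) atTop (𝓝 0) := by
      simpa only [one_div, Function.comp_def] using
        tendsto_inv_atTop_zero.comp (tendsto_natCast_atTop_atTop.comp hM)
    simpa using this.const_mul K

/-! ### Negative correlation of disjoint counts -/

/-- A measurable function with values in `[0, 1]`, evaluated at a random variable, is
integrable. -/
theorem integrable_of_mem_Icc {Ω : Type*} [MeasurableSpace Ω] {P : Measure Ω} [IsFiniteMeasure P]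
    {β : Type*} [MeasurableSpace β] {W : Ω → β} (hW : Measurable W) {f : β → ℝ}
    (hf : Measurable f) (hf0 : ∀ b, 0 ≤ f b ∧ f b ≤ 1) : Integrable (fun ω => f (W ω)) P :=
  Integrable.of_bound (hf.comp hW).aestronglyMeasurable 1 (Eventually.of_forall fun ω => by
    rw [Real.norm_eq_abs, abs_of_nonneg (hf0 _).1]; exact (hf0 _).2)

/-- One step of a random walk with independent increments in `{(1, 0), (0, 1), (0, 0)}`. -/
theorem integral_step {Ω : Type*} [MeasurableSpace Ω] {P : Measure Ω} [IsProbabilityMeasure P]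
    {U W : Ω → ℕ × ℕ} (hU : Measurable U) (hW : Measurable W) (hind : IndepFun U W P)
    (hval : ∀ᵐ ω ∂P, U ω = (1, 0) ∨ U ω = (0, 1) ∨ U ω = (0, 0))
    {φ : ℕ × ℕ → ℝ} (hφ : ∀ b, 0 ≤ φ b ∧ φ b ≤ 1) :
    ∫ ω, φ (U ω + W ω) ∂P =
      P.real {ω | U ω = (1, 0)} * ∫ ω, φ ((1, 0) + W ω) ∂P
      + P.real {ω | U ω = (0, 1)} * ∫ ω, φ ((0, 1) + W ω) ∂P
      + (1 - P.real {ω | U ω = (1, 0)} - P.real {ω | U ω = (0, 1)}) * ∫ ω, φ (W ω) ∂P := by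
  have hms : ∀ v, MeasurableSet {ω | U ω = v} := fun v => hU (measurableSet_singleton v)
  have hp : ∀ (v : ℕ × ℕ) (ψ : ℕ × ℕ → ℝ), ∫ ω, Set.indicator {v} (fun _ => (1 : ℝ)) (U ω)
      * ψ (W ω) ∂P = P.real {ω | U ω = v} * ∫ ω, ψ (W ω) ∂P := by
    intro v ψ
    have h := (hind.comp (measurable_of_countable (Set.indicator {v} (fun _ => (1 : ℝ))))
      (measurable_of_countable ψ)).integral_mul_eq_mul_integral
      ((measurable_of_countable _).comp hU).aestronglyMeasurable
      ((measurable_of_countable _).comp hW).aestronglyMeasurable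
    simp only [Pi.mul_apply, Function.comp_apply] at h
    rw [h]
    congr 1
    rw [← integral_indicator_one (hms v)]
    rfl
  have hint : ∀ (v v' : ℕ × ℕ), Integrable (fun ω => Set.indicator {v} (fun _ => (1 : ℝ)) (U ω)
      * φ (v' + W ω)) P := by
    intro v v'
    refine integrable_of_mem_Icc (hU.prodMk hW)
      (f := fun b => Set.indicator {v} (fun _ => (1 : ℝ)) b.1 * φ (v' + b.2))
      (measurable_of_countable _) fun b => ?_
    have := hφ (v' + b.2)
    by_cases hb : b.1 ∈ ({v} : Set (ℕ × ℕ))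
    · simpa [hb] using this
    · simp [hb]
  have h00 : P.real {ω | U ω = (0, 0)}
      = 1 - P.real {ω | U ω = (1, 0)} - P.real {ω | U ω = (0, 1)} := by
    have h1 : P.real ({ω | U ω = (1, 0)} ∪ ({ω | U ω = (0, 1)} ∪ {ω | U ω = (0, 0)})) = 1 := by
      rw [measureReal_def, (mem_ae_iff_prob_eq_one
        ((hms _).union ((hms _).union (hms _)))).1 hval, ENNReal.toReal_one]
    rw [measureReal_union, measureReal_union] at h1
    · linarith
    · refine Set.disjoint_left.2 fun ω h2 h3 => ?_
      simp only [Set.mem_ofPred_eq] at h2 h3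
      simp [h2] at h3
    · exact hms _
    · refine Set.disjoint_left.2 fun ω h2 h3 => ?_
      simp only [Set.mem_ofPred_eq, Set.mem_union] at h2 h3
      simp [h2] at h3
    · exact (hms _).union (hms _)
  rw [← h00, ← hp (1, 0) fun b => φ ((1, 0) + b), ← hp (0, 1) fun b => φ ((0, 1) + b),
    ← hp (0, 0) φ]
  have e : ∀ ω, φ (W ω) = φ ((0, 0) + W ω) := fun ω => by
    rw [show ((0, 0) : ℕ × ℕ) = 0 from rfl, zero_add]
  simp only [e]
  rw [← integral_add (hint _ _) (hint _ _), ← integral_add (by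
    simpa only [Pi.add_def] using (hint (1, 0) (1, 0)).add (hint (0, 1) (0, 1))) (hint _ _)]
  refine integral_congr_ae ?_
  filter_upwards [hval] with ω hω
  rcases hω with h | h | h <;> simp [h]

/-- Negative correlation: the two coordinates of a sum of independent random elements of
`{(1, 0), (0, 1), (0, 0)}` have negatively correlated antitone functions. -/
theorem integral_mul_le_of_antitone {Ω ι : Type*} [MeasurableSpace Ω] {P : Measure Ω}
    [IsProbabilityMeasure P] {W : ι → Ω → ℕ × ℕ} (hW : ∀ i, Measurable (W i))
    (hind : iIndepFun W P)
    (hval : ∀ i, ∀ᵐ ω ∂P, W i ω = (1, 0) ∨ W i ω = (0, 1) ∨ W i ω = (0, 0)) (T : Finset ι) :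
    ∀ f h : ℕ → ℝ, Antitone f → Antitone h → (∀ b, 0 ≤ f b ∧ f b ≤ 1) →
      (∀ b, 0 ≤ h b ∧ h b ≤ 1) →
      ∫ ω, f (∑ i ∈ T, W i ω).1 * h (∑ i ∈ T, W i ω).2 ∂P
        ≤ (∫ ω, f (∑ i ∈ T, W i ω).1 ∂P) * ∫ ω, h (∑ i ∈ T, W i ω).2 ∂P := by
  classical
  -- Conditioning on the newly added term shifts the argument of f or of h by one, so the induction
  -- must range over all antitone pairs.
  induction T using Finset.induction_on with
  | empty => intro f h _ _ _ _; simp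
  | insert a T ha ih =>
    intro f h hf hh hf0 hh0
    have hS : Measurable fun ω => ∑ i ∈ T, W i ω := Finset.measurable_fun_sum _ fun i _ => hW i
    have hi : IndepFun (W a) (fun ω => ∑ i ∈ T, W i ω) P := by
      have := (hind.indepFun_finsetSum_of_notMem hW ha).symm
      convert this using 1
      ext ω : 1
      simp
    simp only [Finset.sum_insert ha]
    rw [integral_step (hW a) hS hi (hval a) (φ := fun b => f b.1 * h b.2) fun b =>
        ⟨mul_nonneg (hf0 _).1 (hh0 _).1, mul_le_one₀ (hf0 _).2 (hh0 _).1 (hh0 _).2⟩,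
      integral_step (hW a) hS hi (hval a) (φ := fun b => f b.1) fun b => hf0 _,
      integral_step (hW a) hS hi (hval a) (φ := fun b => h b.2) fun b => hh0 _]
    simp only [Prod.fst_add, Prod.snd_add, zero_add]
    have hf' : Antitone fun b => f (1 + b) := fun b b' hb => hf (by omega)
    have hh' : Antitone fun b => h (1 + b) := fun b b' hb => hh (by omega)
    have i1 := ih _ h hf' hh (fun b => hf0 _) hh0
    have i2 := ih f _ hf hh' hf0 fun b => hh0 _
    have i3 := ih f h hf hh hf0 hh0
    have intf : ∀ (k : ℕ → ℕ), Integrable (fun ω => f (k (∑ i ∈ T, W i ω).1)) P := fun k =>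
      integrable_of_mem_Icc hS (f := fun b => f (k b.1)) (measurable_of_countable _) fun b =>
        hf0 _
    have inth : ∀ (k : ℕ → ℕ), Integrable (fun ω => h (k (∑ i ∈ T, W i ω).2)) P := fun k =>
      integrable_of_mem_Icc hS (f := fun b => h (k b.2)) (measurable_of_countable _) fun b =>
        hh0 _
    have m1 : ∫ ω, f (1 + (∑ i ∈ T, W i ω).1) ∂P ≤ ∫ ω, f (∑ i ∈ T, W i ω).1 ∂P :=
      integral_mono (intf fun b => 1 + b) (intf fun b => b) fun ω => hf (by omega)
    have m2 : ∫ ω, h (1 + (∑ i ∈ T, W i ω).2) ∂P ≤ ∫ ω, h (∑ i ∈ T, W i ω).2 ∂P :=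
      integral_mono (inth fun b => 1 + b) (inth fun b => b) fun ω => hh (by omega)
    have hpq : P.real {ω | W a ω = (1, 0)} + P.real {ω | W a ω = (0, 1)} ≤ 1 := by
      rw [← measureReal_union]
      · exact measureReal_le_one
      · refine Set.disjoint_left.2 fun ω h2 h3 => ?_
        simp only [Set.mem_ofPred_eq] at h2 h3
        simp [h2] at h3
      · exact hW a (measurableSet_singleton _)
    have hp0 : 0 ≤ P.real {ω | W a ω = (1, 0)} := measureReal_nonneg
    have hq0 : 0 ≤ P.real {ω | W a ω = (0, 1)} := measureReal_nonneg
    generalize P.real {ω | W a ω = (1, 0)} = p at *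
    generalize P.real {ω | W a ω = (0, 1)} = q at *
    generalize ∫ ω, f (1 + (∑ i ∈ T, W i ω).1) ∂P = F₁ at *
    generalize ∫ ω, f (∑ i ∈ T, W i ω).1 ∂P = F₀ at *
    generalize ∫ ω, h (1 + (∑ i ∈ T, W i ω).2) ∂P = H₁ at *
    generalize ∫ ω, h (∑ i ∈ T, W i ω).2 ∂P = H₀ at *
    have j1 := mul_le_mul_of_nonneg_left i1 hp0
    have j2 := mul_le_mul_of_nonneg_left i2 hq0
    have j3 := mul_le_mul_of_nonneg_left i3 (by linarith : 0 ≤ 1 - p - q)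
    -- After the induction hypotheses, the right side exceeds the left by at least pq(F₀ - F₁)(H₀ -
    -- H₁); this is where p and q being probabilities of disjoint events helps.
    have j4 := mul_nonneg (mul_nonneg hp0 hq0) (mul_nonneg (sub_nonneg.2 m1) (sub_nonneg.2 m2))
    nlinarith

/-! ### Chebyshev's inequality and the bias-variance split -/

/-- Chebyshev's inequality for a sum of independent Bernoulli variables, as a bound for the
difference between its distribution function and that of the point mass at its mean. -/
theorem abs_prob_sub_mul_sq_le {Ω : Type*} [MeasurableSpace Ω] {P : Measure Ω}
    [IsProbabilityMeasure P] {n : ℕ} {Z : Fin n → Ω → ℕ} (hZ : ∀ i, Measurable (Z i))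
    (hind : iIndepFun Z P) (hval : ∀ i, ∀ᵐ ω ∂P, Z i ω = 0 ∨ Z i ω = 1) {p : ℝ}
    (hp : ∀ i, P.real {ω | Z i ω = 1} = p) {r a : ℝ} (ha : a = r * (n * p)) (x : ℝ)
    [Decidable (a ≤ x)] :
    |P.real {ω | r * ((∑ i, Z i ω : ℕ) : ℝ) ≤ x} - if a ≤ x then 1 else 0|
      * (a - x) ^ 2 ≤ r ^ 2 * (n * p) := by
  have hZr : ∀ i, Measurable fun ω => (Z i ω : ℝ) := fun i =>
    (measurable_of_countable _).comp (hZ i)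
  have hLp : ∀ i, MemLp (fun ω => (Z i ω : ℝ)) 2 P := fun i =>
    MemLp.of_bound (hZr i).aestronglyMeasurable 1 (by
      filter_upwards [hval i] with ω hω
      rcases hω with h | h <;> simp [h])
  have hmean : ∀ i, ∫ ω, (Z i ω : ℝ) ∂P = p := fun i => by
    have h1 : P.real {ω | Z i ω = 1} = ∫ ω, Set.indicator {ω | Z i ω = 1} 1 ω ∂P :=
      (integral_indicator_one (hZ i (measurableSet_singleton 1))).symm
    rw [← hp i, h1]
    refine integral_congr_ae ?_
    filter_upwards [hval i] with ω hω
    rcases hω with h | h <;> simp [h, Set.indicator]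
  have hvar : ∀ i, Var[fun ω => (Z i ω : ℝ); P] ≤ p := fun i => by
    rw [variance_eq_sub (hLp i), hmean]
    have : ∫ ω, ((fun ω => (Z i ω : ℝ)) ^ 2) ω ∂P = p := by
      rw [← hmean i]
      refine integral_congr_ae ?_
      filter_upwards [hval i] with ω hω
      rcases hω with h | h <;> simp [h]
    rw [this]
    nlinarith [sq_nonneg p]
  set Y : Ω → ℝ := fun ω => r * ((∑ i, Z i ω : ℕ) : ℝ) with hY
  have hYsum : Y = fun ω => r * (∑ i, fun ω => (Z i ω : ℝ)) ω := by
    ext ω; simp [hY]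
  have hYm : Measurable Y := by
    rw [hYsum]
    simp only [Finset.sum_apply]
    exact (Finset.measurable_fun_sum _ fun i _ => hZr i).const_mul r
  have hsumLp : MemLp (∑ i, fun ω => (Z i ω : ℝ)) 2 P := memLp_finsetSum' _ fun i _ => hLp i
  have hYLp : MemLp Y 2 P := by
    rw [hYsum]
    exact hsumLp.const_mul r
  have hEY : ∫ ω, Y ω ∂P = a := by
    rw [ha, hYsum, integral_const_mul]
    simp only [Finset.sum_apply]
    rw [integral_finsetSum _ fun i _ => (hLp i).integrable (by norm_num)]
    simp [hmean]
  have hVarY : Var[Y; P] ≤ r ^ 2 * (n * p) := by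
    rw [hYsum, variance_const_mul]
    gcongr
    rw [IndepFun.variance_sum (fun i _ => hLp i) fun i _ j _ hij =>
      (hind.indepFun hij).comp (measurable_of_countable fun k : ℕ => (k : ℝ))
        (measurable_of_countable fun k : ℕ => (k : ℝ))]
    refine (Finset.sum_le_sum fun i _ => hvar i).trans ?_
    simp
  -- the difference is at most the probability of a deviation by `|a - x|`
  have hdev : |P.real {ω | Y ω ≤ x} - if a ≤ x then 1 else 0|
      ≤ P.real {ω | |a - x| ≤ |Y ω - ∫ ω, Y ω ∂P|} := by
    rw [hEY]
    split_ifs with hax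
    · have h1 : P.real {ω | Y ω ≤ x} - 1 = - P.real {ω | Y ω ≤ x}ᶜ := by
        rw [probReal_compl_eq_one_sub (measurableSet_le hYm measurable_const)]; ring
      rw [h1, abs_neg, abs_of_nonneg measureReal_nonneg]
      refine measureReal_mono (fun ω hω => ?_)
      simp only [Set.mem_compl_iff, Set.mem_ofPred_eq, not_le] at hω ⊢
      rw [abs_of_nonpos (by linarith), abs_of_nonneg (by linarith)]
      linarith
    · rw [sub_zero, abs_of_nonneg measureReal_nonneg]
      refine measureReal_mono (fun ω hω => ?_)
      simp only [Set.mem_ofPred_eq, not_le] at hω hax ⊢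
      rw [abs_of_pos (by linarith), abs_of_nonpos (by linarith)]
      linarith
  -- At a = x Chebyshev has no positive deviation to work with, but the left side vanishes.
  rcases eq_or_ne a x with hax | hax
  · rw [sub_eq_zero.2 hax]
    have h0 := (variance_nonneg Y P).trans hVarY
    simpa using h0
  · have hpos : 0 < |a - x| := abs_pos.2 (sub_ne_zero.2 hax)
    have hcheb := meas_ge_le_variance_div_sq hYLp hpos
    have hcheb' : P.real {ω | |a - x| ≤ |Y ω - ∫ ω, Y ω ∂P|} ≤ Var[Y; P] / |a - x| ^ 2 :=
      ENNReal.toReal_le_of_le_ofReal (div_nonneg (variance_nonneg _ _) (sq_nonneg _)) hcheb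
    rw [le_div_iff₀ (by positivity), sq_abs] at hcheb'
    calc _ ≤ P.real {ω | |a - x| ≤ |Y ω - ∫ ω, Y ω ∂P|} * (a - x) ^ 2 :=
          mul_le_mul_of_nonneg_right hdev (sq_nonneg _)
      _ ≤ Var[Y; P] := hcheb'
      _ ≤ _ := hVarY

/-- The mean of a family of negatively correlated variables with values in `{0, 1}` has mean
squared error at most the squared bias plus `1 / (4 m)`. -/
theorem integral_sq_mean_sub_le {Ω : Type*} [MeasurableSpace Ω] {P : Measure Ω}
    [IsProbabilityMeasure P] {m : ℕ} (hm : 0 < m) {J : ℕ → Ω → ℝ} (hJ : ∀ j, Measurable (J j))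
    (hJ01 : ∀ j ω, J j ω = 0 ∨ J j ω = 1)
    (hneg : ∀ i < m, ∀ j < m, i ≠ j →
      ∫ ω, J i ω * J j ω ∂P ≤ (∫ ω, J i ω ∂P) * ∫ ω, J j ω ∂P) (F : ℝ) :
    ∫ ω, (1 / (m : ℝ) * ∑ j ∈ Finset.range m, J j ω - F) ^ 2 ∂P
      ≤ 1 / (4 * m) + (1 / (m : ℝ) * ∑ j ∈ Finset.range m, ∫ ω, J j ω ∂P - F) ^ 2 := by
  have hm' : (0 : ℝ) < m := by exact_mod_cast hm
  have hint : ∀ j, Integrable (J j) P := fun j =>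
    Integrable.of_bound (hJ j).aestronglyMeasurable 1 (Eventually.of_forall fun ω => by
      rcases hJ01 j ω with h | h <;> simp [h])
  have hint2 : ∀ i j, Integrable (fun ω => J i ω * J j ω) P := fun i j =>
    Integrable.of_bound ((hJ i).mul (hJ j)).aestronglyMeasurable 1
      (Eventually.of_forall fun ω => by
        rcases hJ01 i ω with h | h <;> rcases hJ01 j ω with h' | h' <;> simp [h, h'])
  set e : ℕ → ℝ := fun j => ∫ ω, J j ω ∂P with he
  set S : Ω → ℝ := fun ω => ∑ j ∈ Finset.range m, J j ω with hS
  set E := ∑ j ∈ Finset.range m, e j with hE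
  have hSS : ∀ ω, S ω ^ 2 = ∑ i ∈ Finset.range m, ∑ j ∈ Finset.range m, J i ω * J j ω := by
    intro ω; rw [sq, Finset.sum_mul_sum]
  have hSint : Integrable S P := integrable_finsetSum _ fun j _ => hint j
  have hS2int : Integrable (fun ω => S ω ^ 2) P := by
    simp only [hSS]
    exact integrable_finsetSum _ fun i _ => integrable_finsetSum _ fun j _ => hint2 i j
  have hES : ∫ ω, S ω ∂P = E := integral_finsetSum _ fun j _ => hint j
  have hES2 : ∫ ω, S ω ^ 2 ∂P ≤ E ^ 2 + m / 4 := by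
    simp only [hSS]
    rw [integral_finsetSum _ fun i _ => integrable_finsetSum _ fun j _ => hint2 i j]
    simp only [integral_finsetSum _ fun j _ => hint2 _ j]
    -- Off the diagonal negative correlation applies; on it J² = J and e ≤ e² + 1/4, the source of
    -- 1/(4m).
    have hterm : ∀ i ∈ Finset.range m, ∑ j ∈ Finset.range m, ∫ ω, J i ω * J j ω ∂P
        ≤ ∑ j ∈ Finset.range m, (e i * e j + if j = i then 1 / 4 else 0) := by
      intro i hi
      refine Finset.sum_le_sum fun j hj => ?_
      split_ifs with hij
      · have : ∫ ω, J i ω * J j ω ∂P = e i := by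
          rw [hij]
          refine integral_congr_ae (Eventually.of_forall fun ω => ?_)
          rcases hJ01 i ω with h | h <;> simp [h]
        rw [this, hij]
        nlinarith [sq_nonneg (e i - 1 / 2)]
      · rw [add_zero]
        exact hneg i (Finset.mem_range.1 hi) j (Finset.mem_range.1 hj) (Ne.symm hij)
    refine (Finset.sum_le_sum hterm).trans_eq ?_
    rw [Finset.sum_congr rfl fun i (hi : i ∈ Finset.range m) => by
      rw [Finset.sum_add_distrib, Finset.sum_ite_eq' (Finset.range m) i, if_pos hi]]
    rw [Finset.sum_add_distrib, ← Finset.sum_mul_sum, sq]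
    simp [div_eq_mul_inv, hE]
  have hexp : ∀ ω, (1 / (m : ℝ) * S ω - F) ^ 2
      = 1 / (m : ℝ) ^ 2 * S ω ^ 2 - 2 * F / m * S ω + F ^ 2 := fun ω => by field_simp; ring
  change ∫ ω, (1 / (m : ℝ) * S ω - F) ^ 2 ∂P ≤ _
  simp only [hexp]
  rw [integral_add (by simpa only [Pi.sub_def] using
      (hS2int.const_mul (1 / (m : ℝ) ^ 2)).sub (hSint.const_mul (2 * F / m))) (integrable_const _),
    integral_sub (hS2int.const_mul _) (hSint.const_mul _), integral_const_mul,
    integral_const_mul, hES]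
  simp only [integral_const, probReal_univ, one_smul]
  calc _ ≤ 1 / (m : ℝ) ^ 2 * (E ^ 2 + m / 4) - 2 * F / m * E + F ^ 2 := by gcongr
    _ = _ := by field_simp; ring

/-! ### Multinomial samples and blocks of cells -/

/-- The events that a random vector is a given unit vector are disjoint. -/
theorem pairwiseDisjoint_eq_single {Ω : Type*} {M : ℕ} (S : Set (Fin M)) (Y : Ω → Fin M → ℕ) :
    S.PairwiseDisjoint fun c => {ω | Y ω = Pi.single c 1} := by
  intro c _ d _ hcd
  refine Set.disjoint_left.2 fun ω h1 h2 => hcd ?_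
  have h3 : (Pi.single c 1 : Fin M → ℕ) c = (Pi.single d 1 : Fin M → ℕ) c := by
    rw [← show Y ω = Pi.single c 1 from h1, ← show Y ω = Pi.single d 1 from h2]
  by_contra hne
  simp [hne] at h3

/-- Each observation is almost surely a unit vector. -/
theorem IsMultinomialSample.ae_exists_eq_single {Ω : Type*} [MeasurableSpace Ω] {P : Measure Ω}
    [IsProbabilityMeasure P] {n M : ℕ} {p : Fin M → ℝ} {X : Fin n → Ω → Fin M → ℕ}
    (hX : IsMultinomialSample P p X) (hp : ∑ c, p c = 1) (i : Fin n) :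
    ∀ᵐ ω ∂P, ∃ c, X i ω = Pi.single c 1 := by
  have hms : ∀ c, MeasurableSet {ω | X i ω = Pi.single c 1} := fun c =>
    hX.measurable i (measurableSet_singleton _)
  have h1 : P.real (⋃ c ∈ (Finset.univ : Finset (Fin M)), {ω | X i ω = Pi.single c 1}) = 1 := by
    rw [measureReal_biUnion_finset (pairwiseDisjoint_eq_single _ _) fun c _ => hms c, ← hp]
    exact Finset.sum_congr rfl fun c _ => hX.law i c
  have h2 : P (⋃ c ∈ (Finset.univ : Finset (Fin M)), {ω | X i ω = Pi.single c 1}) = 1 := by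
    rwa [measureReal_def, ENNReal.toReal_eq_one_iff] at h1
  filter_upwards [(mem_ae_iff_prob_eq_one
    (Finset.measurableSet_biUnion _ fun c _ => hms c)).2 h2] with ω hω
  simpa using hω

/-- The number of entries of a unit vector in a set of cells. -/
theorem sum_single_one {M : ℕ} (S : Finset (Fin M)) (c : Fin M) :
    ∑ d ∈ S, (Pi.single c 1 : Fin M → ℕ) d = if c ∈ S then 1 else 0 := by
  simp [Pi.single_apply]

/-- The probability that an observation falls into a set of cells. -/
theorem IsMultinomialSample.prob_sum_eq_one {Ω : Type*} [MeasurableSpace Ω] {P : Measure Ω}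
    [IsProbabilityMeasure P] {n M : ℕ} {p : Fin M → ℝ} {X : Fin n → Ω → Fin M → ℕ}
    (hX : IsMultinomialSample P p X) (hp : ∑ c, p c = 1) (S : Finset (Fin M)) (i : Fin n) :
    P.real {ω | ∑ c ∈ S, X i ω c = 1} = ∑ c ∈ S, p c := by
  have hms : ∀ c, MeasurableSet {ω | X i ω = Pi.single c 1} := fun c =>
    hX.measurable i (measurableSet_singleton _)
  rw [← Finset.sum_congr rfl fun c _ => hX.law i c,
    ← measureReal_biUnion_finset (pairwiseDisjoint_eq_single _ _) fun c _ => hms c]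
  refine measureReal_congr ?_
  filter_upwards [hX.ae_exists_eq_single hp i] with ω ⟨c, hc⟩
  refine propext ?_
  change ∑ d ∈ S, X i ω d = 1 ↔ ω ∈ ⋃ d ∈ S, {ω | X i ω = Pi.single d 1}
  rw [hc, sum_single_one]
  simp only [Set.mem_iUnion, Set.mem_ofPred_eq, hc]
  constructor
  · intro h
    exact ⟨c, by by_contra hcS; simp [hcS] at h, rfl⟩
  · rintro ⟨d, hd, hcd⟩
    have h3 := congrFun hcd c
    by_cases hne : c = d
    · rw [hne, if_pos hd]
    · simp [hne] at h3

/-- The cells of the `j`-th block of `k` consecutive cells. -/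
def block (k M j : ℕ) : Finset (Fin M) :=
  Finset.univ.filter fun i : Fin M => j * k ≤ (i : ℕ) ∧ (i : ℕ) < (j + 1) * k

/-- Summing over observations last exhibits the count as a sum of independent Bernoulli variables.
-/
theorem groupedCount_eq_sum_block (k : ℕ) {n M : ℕ} (X : Fin n → Fin M → ℕ) (j : ℕ) :
    groupedCount k X j = ∑ i, ∑ c ∈ block k M j, X i c := by
  rw [Finset.sum_comm]
  rfl

theorem disjoint_block {k M i j : ℕ} (hij : i ≠ j) : Disjoint (block k M i) (block k M j) := by
  refine Finset.disjoint_left.2 fun c h1 h2 => hij ?_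
  simp only [block, Finset.mem_filter, Finset.mem_univ, true_and] at h1 h2
  have h3 : i < j + 1 := lt_of_mul_lt_mul_right (h1.1.trans_lt h2.2) (Nat.zero_le k)
  have h4 : j < i + 1 := lt_of_mul_lt_mul_right (h2.1.trans_lt h1.2) (Nat.zero_le k)
  omega

/-- The cell probabilities of a block add up to the increment of `G` over the block. -/
theorem sum_block_cellProb (G : ℝ → ℝ) {k m j : ℕ} (hk : 0 < k) (hj : j < m) :
    ∑ c ∈ block k (k * m) j, cellProb G (k * m) c
      = G (((j : ℝ) + 1) / m) - G ((j : ℝ) / m) := by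
  have hm : (0 : ℝ) < m := by exact_mod_cast (Nat.zero_le j).trans_lt hj
  have hk' : (0 : ℝ) < k := by exact_mod_cast hk
  set f : ℕ → ℝ := fun i => G ((i : ℝ) / ((k * m : ℕ) : ℝ)) with hf
  have h1 : ∑ c ∈ block k (k * m) j, cellProb G (k * m) c
      = ∑ i ∈ Finset.Ico (j * k) ((j + 1) * k), (f (i + 1) - f i) := by
    rw [block, Finset.sum_filter]
    have h2 := Fin.sum_univ_eq_sum_range (fun i =>
      if j * k ≤ i ∧ i < (j + 1) * k then f (i + 1) - f i else 0) (k * m)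
    have h3 : (Finset.range (k * m)).filter (fun i => j * k ≤ i ∧ i < (j + 1) * k)
        = Finset.Ico (j * k) ((j + 1) * k) := by
      ext i
      have : (j + 1) * k ≤ k * m := by rw [mul_comm k]; exact Nat.mul_le_mul_right k hj
      simp only [Finset.mem_filter, Finset.mem_range, Finset.mem_Ico]
      exact ⟨fun h => h.2, fun h => ⟨h.2.trans_le this, h⟩⟩
    rw [← h3, Finset.sum_filter, ← h2]
    refine Finset.sum_congr rfl fun c _ => ?_
    simp only [cellProb, hf, Nat.cast_succ]
  rw [h1, Finset.sum_Ico_eq_sum_range, show (j + 1) * k - j * k = k by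
    rw [Nat.add_mul, one_mul, Nat.add_sub_cancel_left]]
  -- The block telescopes to grid points jk/(km) = j/m and (j + 1)/m.
  have h4 := Finset.sum_range_sub (fun i => f (j * k + i)) k
  simp only [← add_assoc, add_zero] at h4
  rw [h4]
  simp only [hf]
  push_cast
  congr 2 <;> field_simp

/-- The cell probabilities generated by a regular density add up to one. -/
theorem IsRegularDensity.sum_cellProb {μ : Measure ℝ} [IsProbabilityMeasure μ] {g : ℝ → ℝ}
    (hg : IsRegularDensity μ g) {M : ℕ} (hM : 0 < M) : ∑ c, cellProb (cdf μ) M c = 1 := by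
  have hM' : (M : ℝ) ≠ 0 := by exact_mod_cast hM.ne'
  have h0 : cdf μ 0 = 0 := by
    rw [cdf_eq_real, measureReal_def, hg.density, withDensity_apply _ measurableSet_Iic,
      Measure.restrict_restrict measurableSet_Iic]
    have e : Set.Iic (0 : ℝ) ∩ Set.Ioc 0 1 = ∅ :=
      Set.eq_empty_iff_forall_notMem.2 fun u hu => absurd hu.2.1 (not_lt.2 hu.1)
    simp [e]
  have h1 : cdf μ 1 = 1 := by
    have : μ (Set.Ioi 1) = 0 := by
      rw [hg.density, withDensity_apply _ measurableSet_Ioi,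
        Measure.restrict_restrict measurableSet_Ioi]
      have e : Set.Ioi (1 : ℝ) ∩ Set.Ioc 0 1 = ∅ :=
        Set.eq_empty_iff_forall_notMem.2 fun u hu => absurd hu.1 (not_lt.2 hu.2.2)
      simp [e]
    rw [cdf_eq_real, ← Set.compl_Ioi, probReal_compl_eq_one_sub measurableSet_Ioi,
      measureReal_def, this]
    simp
  have h2 := Fin.sum_univ_eq_sum_range (fun i : ℕ =>
    cdf μ (((i + 1 : ℕ) : ℝ) / M) - cdf μ ((i : ℝ) / M)) M
  rw [Finset.sum_range_sub (fun i : ℕ => cdf μ ((i : ℝ) / M)), div_self hM', h1, Nat.cast_zero,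
    zero_div, h0, sub_zero] at h2
  rw [← h2]
  refine Finset.sum_congr rfl fun c _ => ?_
  simp only [cellProb, Nat.cast_succ]

/-! ### The error bound and its asymptotics -/

/-- Nonasymptotic bound for the mean squared error of the grouped estimator. -/
theorem IsRegularDensity.exists_groupedMSE_le {μ : Measure ℝ} [IsProbabilityMeasure μ]
    {g : ℝ → ℝ} (hg : IsRegularDensity μ g) :
    ∃ K : ℝ, 0 < K ∧ ∀ (n M m k : ℕ), 0 < n → 0 < m → 0 < k → M = k * m →
      ∀ {Ω : Type*} [MeasurableSpace Ω] (P : Measure Ω) [IsProbabilityMeasure P]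
        (X : Fin n → Ω → Fin M → ℕ), IsMultinomialSample P (cellProb (cdf μ) M) X →
      ∀ x : ℝ, groupedMSE P m k X (limitDF g) x
        ≤ 1 / (4 * m) + K * (1 / (m : ℝ) ^ 2 + (m : ℝ) / n) := by
  classical
  obtain ⟨-, C, -, hC, -, -, hgC⟩ := hg.exists_bounds
  obtain ⟨K, hK, hbias⟩ := hg.exists_abs_sub_limitDF_le
  refine ⟨2 * K ^ 2 * (1 + C), by positivity, ?_⟩
  rintro n _ m k hn hm hk rfl Ω _ P _ X hX x
  have hn' : (0 : ℝ) < n := by exact_mod_cast hn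
  have hm' : (0 : ℝ) < m := by exact_mod_cast hm
  have hp1 := hg.sum_cellProb (Nat.mul_pos hk hm)
  set f : ℕ → ℝ := fun b => if (m : ℝ) / n * b ≤ x then 1 else 0 with hf
  have hf01 : ∀ b, f b = 0 ∨ f b = 1 := fun b => by
    simp only [hf]; split_ifs <;> simp
  have hfI : ∀ b, 0 ≤ f b ∧ f b ≤ 1 := fun b => by
    rcases hf01 b with h | h <;> simp [h]
  have hfanti : Antitone f := by
    intro b b' hb
    simp only [hf]
    split_ifs with h1 h2
    · exact le_rfl
    · exact absurd ((mul_le_mul_of_nonneg_left (Nat.cast_le.2 hb) (by positivity)).trans h1) h2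
    · exact zero_le_one
    · exact le_rfl
  set Z : ℕ → Fin n → Ω → ℕ := fun j i ω => ∑ c ∈ block k (k * m) j, X i ω c with hZ
  have hZm : ∀ j i, Measurable (Z j i) := fun j i =>
    (measurable_of_countable fun v : Fin (k * m) → ℕ => ∑ c ∈ block k (k * m) j, v c).comp
      (hX.measurable i)
  have hZind : ∀ j, iIndepFun (Z j) P := fun j =>
    hX.indep.comp (fun _ v => ∑ c ∈ block k (k * m) j, v c) fun _ => measurable_of_countable _
  have hZval : ∀ j i, ∀ᵐ ω ∂P, Z j i ω = 0 ∨ Z j i ω = 1 := fun j i => by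
    filter_upwards [hX.ae_exists_eq_single hp1 i] with ω ⟨c, hc⟩
    simp only [hZ, hc, sum_single_one]
    split_ifs <;> simp
  set J : ℕ → Ω → ℝ := fun j ω => f (∑ i, Z j i ω) with hJ
  have hsumm : ∀ j, Measurable fun ω => ∑ i, Z j i ω := fun j =>
    Finset.measurable_fun_sum _ fun i _ => hZm j i
  have hJm : ∀ j, Measurable (J j) := fun j => (measurable_of_countable f).comp (hsumm j)
  have hneg : ∀ i < m, ∀ j < m, i ≠ j →
      ∫ ω, J i ω * J j ω ∂P ≤ (∫ ω, J i ω ∂P) * ∫ ω, J j ω ∂P := by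
    intro i _ j _ hij
    -- An observation is a unit vector and the blocks are disjoint, so it never counts for both.
    have h := integral_mul_le_of_antitone (P := P) (W := fun l ω => (Z i l ω, Z j l ω))
      (fun l => (hZm i l).prodMk (hZm j l))
      (hX.indep.comp (fun _ v => (∑ c ∈ block k (k * m) i, v c, ∑ c ∈ block k (k * m) j, v c))
        fun _ => measurable_of_countable _)
      (fun l => by
        filter_upwards [hX.ae_exists_eq_single hp1 l] with ω ⟨c, hc⟩
        simp only [hZ, hc, sum_single_one]
        have hd := Finset.disjoint_left.1 (disjoint_block (k := k) (M := k * m) hij)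
        by_cases h1 : c ∈ block k (k * m) i
        · simp [h1, hd h1]
        · by_cases h2 : c ∈ block k (k * m) j <;> simp [h1, h2])
      Finset.univ f f hfanti hfanti hfI hfI
    simpa only [Prod.fst_sum, Prod.snd_sum] using h
  have hMSE : groupedMSE P m k X (limitDF g) x
      ≤ 1 / (4 * m) + (1 / (m : ℝ) * ∑ j ∈ Finset.range m, ∫ ω, J j ω ∂P - limitDF g x) ^ 2 := by
    refine le_trans (le_of_eq ?_)
      (integral_sq_mean_sub_le hm hJm (fun j ω => hf01 _) hneg (limitDF g x))
    simp only [groupedMSE, groupedEstimator, groupedCount_eq_sum_block, hJ, hf, hZ]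
  refine hMSE.trans (add_le_add le_rfl ?_)
  have hEJ : ∀ j, ∫ ω, J j ω ∂P = P.real {ω | (m : ℝ) / n * ((∑ i, Z j i ω : ℕ) : ℝ) ≤ x} := by
    intro j
    have hset : MeasurableSet {ω | (m : ℝ) / n * ((∑ i, Z j i ω : ℕ) : ℝ) ≤ x} :=
      measurableSet_le (((measurable_of_countable fun b : ℕ => (b : ℝ)).comp
        (hsumm j)).const_mul _) measurable_const
    rw [← integral_indicator_one hset]
    refine integral_congr_ae (Eventually.of_forall fun ω => ?_)
    simp only [hJ, hf, Set.indicator, Set.mem_ofPred_eq, Pi.one_apply]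
  -- The normalized count has mean a_j and variance at most (m/n)a_j, and a_j ≤ C as a value of g.
  have hb := hbias m hm _ (fun j => ∫ ω, J j ω ∂P) x (m / n * C) (fun _ => rfl) (by positivity)
    (fun j _ => by rw [hEJ]; exact ⟨measureReal_nonneg, measureReal_le_one⟩)
    (fun j hj => by
      rw [hEJ]
      have hpj : ∀ i, P.real {ω | Z j i ω = 1}
          = cdf μ (((j : ℝ) + 1) / m) - cdf μ ((j : ℝ) / m) := fun i => by
        rw [← sum_block_cellProb _ hk hj]
        exact hX.prob_sum_eq_one hp1 _ i
      have hch := abs_prob_sub_mul_sq_le (hZm j) (hZind j) (hZval j) hpj (r := (m : ℝ) / n)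
        (a := m * (cdf μ (((j : ℝ) + 1) / m) - cdf μ ((j : ℝ) / m))) (by field_simp) x
      obtain ⟨u, -, hu, hau⟩ := hg.exists_mul_cdf_sub_eq hj
      refine hch.trans ?_
      calc _ = (m : ℝ) / n * (m * (cdf μ (((j : ℝ) + 1) / m) - cdf μ ((j : ℝ) / m))) := by
            field_simp
        _ ≤ _ := by rw [hau]; exact mul_le_mul_of_nonneg_left (hgC u hu) (by positivity))
  calc (1 / (m : ℝ) * ∑ j ∈ Finset.range m, ∫ ω, J j ω ∂P - limitDF g x) ^ 2
      ≤ (K * (1 / m + √(m / n * C))) ^ 2 := by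
        rw [← sq_abs]; exact pow_le_pow_left₀ (abs_nonneg _) hb 2
    _ ≤ K ^ 2 * (2 * ((1 / (m : ℝ)) ^ 2 + √(m / n * C) ^ 2)) := by
        rw [mul_pow]; gcongr; exact add_sq_le
    _ = K ^ 2 * (2 * (1 / (m : ℝ) ^ 2 + m / n * C)) := by
        rw [Real.sq_sqrt (by positivity), div_pow, one_pow]
    _ ≤ _ := by
        have e1 : 0 ≤ 1 / (m : ℝ) ^ 2 := by positivity
        have e2 : 0 ≤ (m : ℝ) / n := by positivity
        have e3 : 1 / (m : ℝ) ^ 2 + m / n * C ≤ (1 + C) * (1 / (m : ℝ) ^ 2 + m / n) := by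
          nlinarith [mul_nonneg hC.le e1]
        calc _ ≤ K ^ 2 * (2 * ((1 + C) * (1 / (m : ℝ) ^ 2 + m / n))) := by gcongr
          _ = _ := by ring

theorem theorem1p3
    -- the distribution function `G = cdf μ` with density `g`
    (μ : Measure ℝ) [IsProbabilityMeasure μ] (g : ℝ → ℝ) (hg : IsRegularDensity μ g)
    -- sample sizes, numbers of cells, numbers of groups and group sizes
    (n M m k : ℕ → ℕ) (lam : ℝ) (hlam : 0 < lam)
    (hn : Tendsto n atTop atTop) (hM : Tendsto M atTop atTop)
    (hnM : Tendsto (fun l => (n l : ℝ) / (M l : ℝ)) atTop (𝓝 lam))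
    (hMkm : ∀ l, M l = k l * m l)
    (hm : Tendsto m atTop atTop)
    (α : ℝ) (hα : 0 < α) (hα' : α < 1 / 6)
    (hrate : Tendsto
      (fun l => (n l : ℝ) / ((m l : ℝ) * Real.log (m l) ^ (1 / (2 * α)))) atTop atTop)
    -- the observations
    {Ω : ℕ → Type*} [∀ l, MeasurableSpace (Ω l)]
    (P : ∀ l, Measure (Ω l)) [∀ l, IsProbabilityMeasure (P l)]
    (X : ∀ l, Fin (n l) → Ω l → Fin (M l) → ℕ)
    (hX : ∀ l, IsMultinomialSample (P l) (cellProb (cdf μ) (M l)) (X l))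
    (x : ℝ) :
    -- `F` is the weak limit of the structural distribution functions
    (∀ y, ContinuousAt (limitDF g) y →
      Tendsto (fun l => structuralDF (cellProb (cdf μ) (M l)) y) atTop (𝓝 (limitDF g y))) ∧
    -- `F` has a bounded density; `τ` below is any bound of it
    (∃ τ : ℝ, HasDensityBoundedBy (limitLaw g) τ) ∧
    -- the case `m ≫ n ^ (1 / 3)`
    ((fun l => (n l : ℝ) ^ (1 / 3 : ℝ)) =o[atTop] (fun l => (m l : ℝ)) →
      ∀ τ : ℝ, HasDensityBoundedBy (limitLaw g) τ →
      ∃ r₁ r₂ : ℕ → ℝ,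
        r₁ =o[atTop] (fun l => ((m l : ℝ) / (n l : ℝ)) ^ (2 / 3 : ℝ)) ∧
        r₂ =o[atTop] (fun l => 1 / (m l : ℝ)) ∧
        ∀ᶠ l in atTop, groupedMSE (P l) (m l) (k l) (X l) (limitDF g) x ≤
          9 / (4 * Real.pi ^ 2) * (24 * τ) ^ (4 / 3 : ℝ) *
              ((m l : ℝ) / (n l : ℝ)) ^ (2 / 3 : ℝ)
            + 1 / (4 * (m l : ℝ)) + r₁ l + r₂ l) ∧
    -- the case `m ≪ n ^ (1 / 3)`
    ((fun l => (m l : ℝ)) =o[atTop] (fun l => (n l : ℝ) ^ (1 / 3 : ℝ)) →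
      ∃ r : ℕ → ℝ,
        r =o[atTop] (fun l => 1 / (m l : ℝ)) ∧
        ∀ᶠ l in atTop, groupedMSE (P l) (m l) (k l) (X l) (limitDF g) x ≤
          1 / (4 * (m l : ℝ)) + r l) := by
  have hnR : Tendsto (fun l => (n l : ℝ)) atTop atTop := tendsto_natCast_atTop_atTop.comp hn
  have hmR : Tendsto (fun l => (m l : ℝ)) atTop atTop := tendsto_natCast_atTop_atTop.comp hm
  obtain ⟨K, hK, hMSE⟩ := hg.exists_groupedMSE_le
  have hpos : ∀ᶠ l in atTop, 0 < n l ∧ 0 < m l ∧ 0 < k l := by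
    filter_upwards [hn.eventually_gt_atTop 0, hm.eventually_gt_atTop 0,
      hM.eventually_gt_atTop 0] with l h1 h2 h3
    refine ⟨h1, h2, Nat.pos_of_ne_zero fun h => ?_⟩
    rw [hMkm, h, zero_mul] at h3
    exact h3.false
  have hbound : ∀ᶠ l in atTop, groupedMSE (P l) (m l) (k l) (X l) (limitDF g) x
      ≤ 1 / (4 * (m l : ℝ)) + K * (1 / (m l : ℝ) ^ 2 + (m l : ℝ) / n l) := by
    filter_upwards [hpos] with l ⟨h1, h2, h3⟩
    exact hMSE (n l) (M l) (m l) (k l) h1 h2 h3 (hMkm l) (P l) (X l) (hX l) x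
  have hsmall : (fun l => K * (1 / (m l : ℝ) ^ 2)) =o[atTop] fun l => 1 / (m l : ℝ) := by
    refine IsLittleO.const_mul_left ?_ K
    refine isLittleO_of_tendsto' ?_ (Tendsto.congr' ?_ (tendsto_inv_atTop_zero.comp hmR))
    · filter_upwards [hpos] with l ⟨_, h2, _⟩ h
      have : (0 : ℝ) < m l := by exact_mod_cast h2
      exact absurd h (by positivity)
    · filter_upwards [hpos] with l ⟨_, h2, _⟩
      have : (0 : ℝ) < m l := by exact_mod_cast h2
      simp only [Function.comp_apply]
      field_simp
  refine ⟨fun y _ => hg.tendsto_structuralDF hM y, hg.exists_hasDensityBoundedBy, ?_, ?_⟩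
  · rintro - τ ⟨f, -, hfτ, -⟩
    -- It makes the leading term in the claim nonnegative; the remainders alone already cover the
    -- bias.
    have hτ : 0 ≤ τ := (f 0).coe_nonneg.trans (hfτ 0)
    -- The power of log m is eventually at least 1, so the rate condition forces n/m → ∞.
    have hratio : Tendsto (fun l => (n l : ℝ) / m l) atTop atTop := by
      refine tendsto_atTop_mono' atTop ?_ hrate
      filter_upwards [hpos, (Real.tendsto_log_atTop.comp hmR).eventually_ge_atTop 1]
        with l ⟨_, h2, _⟩ h4
      have h2' : (0 : ℝ) < m l := by exact_mod_cast h2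
      have h5 : 1 ≤ Real.log (m l) ^ (1 / (2 * α)) := Real.one_le_rpow h4 (by positivity)
      exact div_le_div_of_nonneg_left (by positivity) h2' (le_mul_of_one_le_right h2'.le h5)
    have hy : Tendsto (fun l => (m l : ℝ) / n l) atTop (𝓝 0) := by
      simpa only [Function.comp_def, inv_div] using tendsto_inv_atTop_zero.comp hratio
    refine ⟨fun l => K * ((m l : ℝ) / n l), fun l => K * (1 / (m l : ℝ) ^ 2), ?_, hsmall, ?_⟩
    · refine IsLittleO.const_mul_left ?_ K
      have hcube : Tendsto (fun l => ((m l : ℝ) / n l) ^ (1 / 3 : ℝ)) atTop (𝓝 0) := by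
        have := hy.rpow_const (p := 1 / 3) (Or.inr (by norm_num))
        rwa [Real.zero_rpow (by norm_num)] at this
      refine isLittleO_of_tendsto' ?_ (Tendsto.congr' ?_ hcube)
      · filter_upwards [hpos] with l ⟨h1, h2, _⟩ h
        have h1' : (0 : ℝ) < n l := by exact_mod_cast h1
        have h2' : (0 : ℝ) < m l := by exact_mod_cast h2
        exact absurd h (by positivity)
      · filter_upwards [hpos] with l ⟨h1, h2, _⟩
        have h1' : (0 : ℝ) < n l := by exact_mod_cast h1
        have h2' : (0 : ℝ) < m l := by exact_mod_cast h2
        have hq : (0 : ℝ) < m l / n l := by positivity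
        rw [eq_div_iff (by positivity), ← Real.rpow_add hq]
        norm_num
    · filter_upwards [hbound] with l hl
      have : 0 ≤ 9 / (4 * Real.pi ^ 2) * (24 * τ) ^ (4 / 3 : ℝ) *
          ((m l : ℝ) / (n l : ℝ)) ^ (2 / 3 : ℝ) := by positivity
      linarith
  · intro hmn
    refine ⟨fun l => K * (1 / (m l : ℝ) ^ 2) + K * ((m l : ℝ) / n l),
      hsmall.add (IsLittleO.const_mul_left ?_ K), ?_⟩
    · have h1 : (fun l => (m l : ℝ) * m l) =o[atTop] fun l => (n l : ℝ) := by
        refine (hmn.mul hmn).trans_isBigO (IsBigO.of_bound 1 ?_)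
        filter_upwards [hpos] with l ⟨h1, _, _⟩
        have h1' : (1 : ℝ) ≤ n l := by exact_mod_cast h1
        rw [← Real.rpow_add (by linarith), Real.norm_of_nonneg (by positivity),
          Real.norm_of_nonneg (by positivity), one_mul]
        calc (n l : ℝ) ^ (1 / 3 + 1 / 3 : ℝ) ≤ (n l : ℝ) ^ (1 : ℝ) :=
              Real.rpow_le_rpow_of_exponent_le h1' (by norm_num)
          _ = n l := Real.rpow_one _
      have h2 := h1.mul_isBigO (isBigO_refl (fun l => 1 / ((m l : ℝ) * n l)) atTop)
      refine h2.congr' ?_ ?_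
      · filter_upwards [hpos] with l ⟨h1, h2, _⟩
        have h1' : (0 : ℝ) < n l := by exact_mod_cast h1
        have h2' : (0 : ℝ) < m l := by exact_mod_cast h2
        field_simp
      · filter_upwards [hpos] with l ⟨h1, h2, _⟩
        have h1' : (0 : ℝ) < n l := by exact_mod_cast h1
        have h2' : (0 : ℝ) < m l := by exact_mod_cast h2
        field_simp
    · filter_upwards [hbound] with l hl
      linarith
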